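/- Let $\mathcal{A}$ be a Boolean algebra. Let $St(\mathcal{A})$ be its Stone space, that is, the set of ultrafilters on $\mathcal{A}$ with the topology generated by the sets $\{x : a\in x\}$, $a\in\mathcal{A}$, and let $C(St(\mathcal{A}))$ be the Banach space of continuous real-valued functions on $St(\mathcal{A})$ with the supremum norm. One says that $\mathcal{A}$ has the Grothendieck property if $C(St(\mathcal{A}))$ is a Grothendieck space, that is, every weak* convergent sequence in the dual space $C(St(\mathcal{A}))^*$ is weakly convergent. Let $ba(\mathcal{A})$ be the space of bounded finitely additive signed (real-valued) measures on $\mathcal{A}$; for $\nu\in ba(\mathcal{A})$ and $a\in\mathcal{A}$ let $|\nu|(a)$ be the variation of $\nu$ on $a$, that is, the supremum of $\sum_{b\in P}|\nu(b)|$ over all finite partitions $P$ of $a$ into pairwise disjoint nonzero elements of $\mathcal{A}$, and let $\|\nu\|=|\nu|(1_{\mathcal{A}})$. Then $\mathcal{A}$ has the Grothendieck property if and only if it satisfies the following condition: ($\dagger$) for every $\varepsilon\in(0,1)$ and every sequence $(\nu_n)_{n\in\mathbb{N}}$ in $ba(\mathcal{A})$ with $\|\nu_n\|=1$ for each $n\in\mathbb{N}$,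 if there exists a sequence $(H_n)_{n\in\mathbb{N}}$ in $\mathcal{A}$ such that $H_i\wedge H_j=0_{\mathcal{A}}$ for all $i\neq j$ (an antichain) and $|\nu_n|(H_n)\ge 1-\varepsilon$ for each $n\in\mathbb{N}$, then there exists $B\in\mathcal{A}$ such that the limit $\lim_{n\to\infty}\nu_n(B)$ does not exist. -/

import Mathlib

open Filter Topology

universe u v

/-- A real Banach space `X` is a *Grothendieck space* if every weak* convergent sequence in the
dual `X*` is weakly convergent, i.e. convergent for the topology on `X*` induced by `X**`. -/
def IsGrothendieckSpace (X : Type u) [NormedAddCommGroup X] [NormedSpace ℝ X] : Prop :=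
  ∀ f : ℕ → StrongDual ℝ X,
    (∃ g : WeakDual ℝ X, Tendsto (fun n => StrongDual.toWeakDual (f n)) atTop (𝓝 g)) →
    ∃ g : WeakSpace ℝ (StrongDual ℝ X),
      Tendsto (fun n => toWeakSpace ℝ (StrongDual ℝ X) (f n)) atTop (𝓝 g)

/-- The Stone space of a Boolean algebra: the set of its ultrafilters. -/
@[ext]
structure StoneSpace (A : Type u) [BooleanAlgebra A] where
  /-- The elements of the ultrafilter. -/
  carrier : Set A
  top_mem : ⊤ ∈ carrier
  bot_notMem : ⊥ ∉ carrier
  mem_of_le : ∀ {a b : A}, a ≤ b → a ∈ carrier → b ∈ carrier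
  inf_mem : ∀ {a b : A}, a ∈ carrier → b ∈ carrier → a ⊓ b ∈ carrier
  mem_or_compl_mem : ∀ a : A, a ∈ carrier ∨ aᶜ ∈ carrier

namespace StoneSpace

variable {A : Type u} [BooleanAlgebra A]

/-- The basic clopen set `[a]` of all ultrafilters that contain `a`. -/
def basicSet (a : A) : Set (StoneSpace A) := {x | a ∈ x.carrier}

/-- The Stone topology, generated by the sets `[a]`. They are closed under finite intersections,
so they form a base. -/
instance : TopologicalSpace (StoneSpace A) :=
  TopologicalSpace.generateFrom (Set.range (basicSet (A := A)))

theorem isOpen_basicSet (a : A) : IsOpen (basicSet a) :=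
  TopologicalSpace.isOpen_generateFrom_of_mem ⟨a, rfl⟩

theorem compl_mem_iff (x : StoneSpace A) (a : A) : aᶜ ∈ x.carrier ↔ a ∉ x.carrier := by
  constructor
  · intro h h'
    apply x.bot_notMem
    have := x.inf_mem h' h
    rwa [inf_compl_eq_bot] at this
  · intro h
    exact (x.mem_or_compl_mem a).resolve_left h

instance : CompactSpace (StoneSpace A) := by
  rw [← isCompact_univ_iff, isCompact_iff_ultrafilter_le_nhds]
  intro U _
  refine ⟨⟨{a | basicSet a ∈ U}, ?_, ?_, ?_, ?_, ?_⟩, Set.mem_univ _, ?_⟩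
  · exact Filter.mem_of_superset Filter.univ_mem fun x _ => x.top_mem
  · intro h
    obtain ⟨x, hx⟩ := U.nonempty_of_mem h
    exact x.bot_notMem hx
  · intro a b hab h
    exact Filter.mem_of_superset h fun x hx => x.mem_of_le hab hx
  · intro a b ha hb
    exact Filter.mem_of_superset (Filter.inter_mem ha hb) fun x hx => x.inf_mem hx.1 hx.2
  · intro a
    rcases U.mem_or_compl_mem (basicSet a) with h | h
    · exact Or.inl h
    · exact Or.inr (Filter.mem_of_superset h fun x hx => (x.compl_mem_iff a).2 hx)
  · rw [← Filter.tendsto_id', TopologicalSpace.tendsto_nhds_generateFrom_iff]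
    rintro _ ⟨a, rfl⟩ ha
    exact ha

instance : T2Space (StoneSpace A) := by
  refine ⟨fun x y hxy => ?_⟩
  have key : ∃ a, a ∈ x.carrier ∧ a ∉ y.carrier := by
    by_contra! h
    refine hxy (StoneSpace.ext (Set.Subset.antisymm h fun a ha => ?_))
    by_contra hax
    exact (y.compl_mem_iff a).1 (h _ ((x.compl_mem_iff a).2 hax)) ha
  obtain ⟨a, hx, hy⟩ := key
  refine ⟨basicSet a, basicSet aᶜ, isOpen_basicSet a, isOpen_basicSet aᶜ, hx,
    (y.compl_mem_iff a).2 hy, Set.disjoint_left.2 fun z hz hz' => (z.compl_mem_iff a).1 hz' hz⟩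

end StoneSpace

/-- A Boolean algebra `A` has the *Grothendieck property* if the Banach space `C(St(A))` of
continuous real-valued functions on its Stone space, with the supremum norm, is a
Grothendieck space. -/
def HasGrothendieckProperty (A : Type u) [BooleanAlgebra A] : Prop :=
  IsGrothendieckSpace C(StoneSpace A, ℝ)

/-- `ba(A)`: the bounded, finitely additive, signed (real-valued) measures on `A`. -/
@[ext]
structure BoundedCharge (A : Type u) [BooleanAlgebra A] where
  /-- The underlying set function. -/
  toFun : A → ℝ
  map_sup' : ∀ a b : A, Disjoint a b → toFun (a ⊔ b) = toFun a + toFun b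
  bounded' : ∃ C : ℝ, ∀ a : A, |toFun a| ≤ C

namespace BoundedCharge

variable {A : Type u} [BooleanAlgebra A]

instance : CoeFun (BoundedCharge A) (fun _ => A → ℝ) := ⟨toFun⟩

/-- The variation `|ν|(a)`: the supremum of `∑ |ν(b)|` over all finite partitions of `a`. -/
noncomputable def variation (ν : BoundedCharge A) (a : A) : ℝ :=
  ⨆ P : Finpartition a, ∑ b ∈ P.parts, |ν b|

/-- The total variation norm `‖ν‖ = |ν|(1)`. -/
noncomputable instance : Norm (BoundedCharge A) := ⟨fun ν => ν.variation ⊤⟩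

theorem norm_def (ν : BoundedCharge A) : ‖ν‖ = ν.variation ⊤ := rfl

theorem map_bot (ν : BoundedCharge A) : ν ⊥ = 0 := by
  have := ν.map_sup' ⊥ ⊥ disjoint_bot_left
  rw [sup_bot_eq] at this
  linarith

theorem map_finset_sup (ν : BoundedCharge A) (s : Finset A) (hs : s.SupIndep id) :
    ν (s.sup id) = ∑ b ∈ s, ν b := by
  classical
  induction s using Finset.induction_on with
  | empty => simpa using ν.map_bot
  | insert b s hb ih =>
    rw [Finset.sup_insert, Finset.sum_insert hb, id_eq,
      ν.map_sup' b _ (hs (Finset.subset_insert b s) (Finset.mem_insert_self b s) hb),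
      ih (hs.subset (Finset.subset_insert b s))]

/-- The supremum that defines the variation is that of a bounded set of reals. -/
theorem bddAbove_variation (ν : BoundedCharge A) (a : A) :
    BddAbove (Set.range fun P : Finpartition a => ∑ b ∈ P.parts, |ν b|) := by
  classical
  obtain ⟨C, hC⟩ := ν.bounded'
  refine ⟨C + C, ?_⟩
  rintro _ ⟨P, rfl⟩
  have h1 := ν.map_finset_sup _ (P.supIndep.subset (Finset.filter_subset (fun b => 0 ≤ ν b) _))
  have h2 := ν.map_finset_sup _ (P.supIndep.subset (Finset.filter_subset (fun b => ¬ 0 ≤ ν b) _))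
  have e1 : ∑ b ∈ P.parts with 0 ≤ ν b, |ν b| = ∑ b ∈ P.parts with 0 ≤ ν b, ν b :=
    Finset.sum_congr rfl fun b hb => abs_of_nonneg (Finset.mem_filter.1 hb).2
  have e2 : ∑ b ∈ P.parts with ¬ 0 ≤ ν b, |ν b| = - ∑ b ∈ P.parts with ¬ 0 ≤ ν b, ν b := by
    rw [← Finset.sum_neg_distrib]
    exact Finset.sum_congr rfl fun b hb => abs_of_neg (not_le.1 (Finset.mem_filter.1 hb).2)
  change ∑ b ∈ P.parts, |ν b| ≤ C + C
  rw [← Finset.sum_filter_add_sum_filter_not P.parts (fun b => 0 ≤ ν b), e1, e2, ← h1, ← h2]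
  exact add_le_add ((le_abs_self _).trans (hC _)) ((neg_le_abs _).trans (hC _))

end BoundedCharge

/-- A family of elements of a Boolean algebra is an *antichain* if `H i ∧ H j = 0` for all
`i ≠ j`. -/
def IsBooleanAntichain {A : Type u} [BooleanAlgebra A] {ι : Type v} (H : ι → A) : Prop :=
  ∀ i j : ι, i ≠ j → H i ⊓ H j = ⊥

/-!
Bounded charges on `A` and functionals on `C(St(A))` are passed back and forth through
`BoundedCharge.ofDual` and `BoundedCharge.exists_dual`; on bounded sequences, weak* convergence is
pointwise convergence on `A` (`exists_dual_tendsto`).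

If `C(St(A))` is a Grothendieck space, a pointwise convergent bounded sequence `νₙ` of charges is
weakly convergent. Choose `cₙ ≤ Hₙ` with `|νₙ|(Hₙ) ≤ 4 |νₙ(cₙ)|`. Summation of `ν(cₖ)` over any set
of indices `k` is an element of the bidual, so after subtracting the limit all subseries of
`(νₙ(cₖ))ₖ` tend to `0` as `n → ∞`. A gliding hump argument
(`tendsto_diag_of_tendsto_tsum_indicator`) then gives `νₙ(cₙ) → 0`, so `|νₙ|(Hₙ)` cannot stay above
`1 - ε > 0`.

For the converse, suppose that `hₙ` is weak* null and `φ(hₙ) ≥ η > 0` for some `φ` in the bidual.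
By Goldstine's theorem the convex sets `{f | ‖f‖ ≤ R, hᵢ(f) ≥ η / 2 for i < n}` are nonempty. Let
`λ = ∑ 2⁻ⁿ |νₙ|`, where `νₙ` is the charge of `hₙ`. Nearly minimizing `∫ f² dλ` over these sets gives
an `L²(λ)`-Cauchy sequence `gₙ`, by the parallelogram identity. Since `hᵢ(gₙ) → 0` as `i → ∞`, there
are `n < m` and `i` such that `hᵢ(gₘ - gₙ) ≥ η / 4` while `gₘ - gₙ` is small in `L²(λ)`
(`exists_apply_sq_le`). The clopen sets where `|gₘ - gₙ|` is not small have small `λ`-measure but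
`|νᵢ|`-measure bounded below, so the `νᵢ` are not uniformly absolutely continuous with respect to
`λ`. A uniformly exhaustive sequence of charges would be
(`BoundedCharge.exists_antichain_of_control`), so some antichain `cₖ` and indices `nₖ → ∞` satisfy
`|ν_{nₖ}|(cₖ) ≥ δ > 0`. Normalizing these charges gives a sequence that tends to `0` pointwise and
violates the condition, with an `ε < 1` that depends on `δ`; this is where the condition is used for
`ε` close to `1`.
-/

/-! ### The variation of a bounded charge -/

namespace BoundedCharge

variable {A : Type u} [BooleanAlgebra A]

theorem variation_nonneg (ν : BoundedCharge A) (a : A) : 0 ≤ ν.variation a :=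
  Real.iSup_nonneg fun _ => Finset.sum_nonneg fun _ _ => abs_nonneg _

theorem variation_le {ν : BoundedCharge A} {a : A} {C : ℝ}
    (h : ∀ P : Finpartition a, ∑ b ∈ P.parts, |ν b| ≤ C) : ν.variation a ≤ C :=
  ciSup_le h

/-- The variation dominates sums over finite disjoint families below `a`, which need neither
exhaust `a` nor avoid `⊥`. -/
theorem sum_abs_le_variation {ι : Type*} (ν : BoundedCharge A) {a : A} (s : Finset ι) (c : ι → A)
    (hd : (s : Set ι).PairwiseDisjoint c) (hle : ∀ i ∈ s, c i ≤ a) :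
    ∑ i ∈ s, |ν (c i)| ≤ ν.variation a := by
  classical
  have hd' : ((s.image c : Finset A) : Set A).PairwiseDisjoint id := by
    intro x hx y hy hxy
    simp only [Finset.coe_image, Set.mem_image, Finset.mem_coe] at hx hy
    obtain ⟨i, hi, rfl⟩ := hx
    obtain ⟨j, hj, rfl⟩ := hy
    exact hd hi hj fun h => hxy (by rw [h])
  have h0 : |ν ⊥| = 0 := by rw [ν.map_bot, abs_zero]
  have hsup : (s.image c).sup id ≤ a := by
    simpa using hle
  let Q := Finpartition.ofPairwiseDisjoint (s.image c) hd'
  calc ∑ i ∈ s, |ν (c i)| = ∑ b ∈ s.image c, |ν b| :=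
        (Finset.sum_image_of_disjoint (g := fun b => |ν b|) h0 hd).symm
    _ = ∑ b ∈ Q.parts, |ν b| :=
        (Finpartition.sum_ofPairwiseDisjoint_eq_sum hd' (f := fun b => |ν b|) h0).symm
    _ ≤ ∑ b ∈ (Q.extendOfLE hsup).parts, |ν b| :=
        Finset.sum_le_sum_of_subset_of_nonneg (Q.parts_subset_extendOfLE hsup)
          fun _ _ _ => abs_nonneg _
    _ ≤ ν.variation a := le_ciSup (ν.bddAbove_variation a) (Q.extendOfLE hsup)

theorem variation_mono (ν : BoundedCharge A) {a b : A} (h : a ≤ b) :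
    ν.variation a ≤ ν.variation b :=
  variation_le fun P => ν.sum_abs_le_variation P.parts id P.disjoint fun _ hi => (P.le hi).trans h

theorem sum_disjoint (ν : BoundedCharge A) {ι : Type*} (s : Finset ι) (c : ι → A)
    (hd : (s : Set ι).PairwiseDisjoint c) : ν (s.sup c) = ∑ i ∈ s, ν (c i) := by
  classical
  induction s using Finset.induction_on with
  | empty => simpa using ν.map_bot
  | insert i s hi ih =>
    rw [Finset.sup_insert, Finset.sum_insert hi, ν.map_sup',
      ih (hd.subset (by simp))]
    rw [Finset.disjoint_sup_right]
    intro j hj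
    exact hd (by simp) (by simp [hj]) fun h => hi (h ▸ hj)

theorem variation_sup (ν : BoundedCharge A) (a b : A) (h : Disjoint a b) :
    ν.variation (a ⊔ b) = ν.variation a + ν.variation b := by
  apply le_antisymm
  · refine variation_le fun P => ?_
    have hP : ∀ d, ∑ p ∈ P.parts, |ν (p ⊓ d)| ≤ ν.variation d := fun d =>
      ν.sum_abs_le_variation P.parts (fun p => p ⊓ d)
        (fun i hi j hj hij => (P.disjoint hi hj hij).mono inf_le_left inf_le_left)
        fun _ _ => inf_le_right
    calc ∑ p ∈ P.parts, |ν p| ≤ ∑ p ∈ P.parts, (|ν (p ⊓ a)| + |ν (p ⊓ b)|) := by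
          refine Finset.sum_le_sum fun p hp => ?_
          have : ν p = ν (p ⊓ a) + ν (p ⊓ b) := by
            rw [← ν.map_sup' _ _ (h.mono inf_le_right inf_le_right), ← inf_sup_left,
              inf_eq_left.2 (P.le hp)]
          rw [this]
          exact abs_add_le _ _
      _ ≤ ν.variation a + ν.variation b := by
          rw [Finset.sum_add_distrib]
          exact add_le_add (hP a) (hP b)
  · rw [← le_sub_iff_add_le]
    refine variation_le fun P => ?_
    rw [le_sub_comm]
    refine variation_le fun Q => ?_
    rw [le_sub_iff_add_le, add_comm]
    have := ν.sum_abs_le_variation (a := a ⊔ b) (P.parts.disjSum Q.parts) (Sum.elim id id) ?_ ?_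
    · simpa [Finset.sum_disjSum] using this
    · rintro (i | i) hi (j | j) hj hij <;>
        simp only [Finset.mem_coe, Finset.inl_mem_disjSum, Finset.inr_mem_disjSum] at hi hj
      · exact P.disjoint hi hj fun h : i = j => hij (by rw [h])
      · exact h.mono (P.le hi) (Q.le hj)
      · exact h.symm.mono (Q.le hi) (P.le hj)
      · exact Q.disjoint hi hj fun h : i = j => hij (by rw [h])
    · rintro (i | i) hi <;>
        simp only [Finset.inl_mem_disjSum, Finset.inr_mem_disjSum] at hi
      · exact (P.le hi).trans le_sup_left
      · exact (Q.le hi).trans le_sup_right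

/-- The variation `|ν|` as a charge. -/
noncomputable def variationCharge (ν : BoundedCharge A) : BoundedCharge A where
  toFun := ν.variation
  map_sup' := ν.variation_sup
  bounded' := ⟨ν.variation ⊤, fun a => by
    rw [abs_of_nonneg (ν.variation_nonneg a)]
    exact ν.variation_mono le_top⟩

/-- Scalar multiples of a charge. -/
def smul (c : ℝ) (ν : BoundedCharge A) : BoundedCharge A where
  toFun a := c * ν a
  map_sup' a b h := by rw [ν.map_sup' a b h, mul_add]
  bounded' := by
    obtain ⟨C, hC⟩ := ν.bounded'
    refine ⟨|c| * C, fun a => ?_⟩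
    rw [abs_mul]
    exact mul_le_mul_of_nonneg_left (hC a) (abs_nonneg c)

theorem variation_smul (c : ℝ) (ν : BoundedCharge A) (a : A) :
    (smul c ν).variation a = |c| * ν.variation a := by
  unfold variation
  rw [Real.mul_iSup_of_nonneg (abs_nonneg c)]
  simp only [Finset.mul_sum, smul, abs_mul]

/-- Keeping only the parts of one sign in a partition that nearly attains the variation. -/
theorem exists_variation_le_mul_abs (ν : BoundedCharge A) (a : A) :
    ∃ c ≤ a, ν.variation a ≤ 4 * |ν c| := by
  classical
  rcases (ν.variation_nonneg a).eq_or_lt with h0 | h0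
  · exact ⟨⊥, bot_le, by rw [← h0]; positivity⟩
  obtain ⟨P, hP⟩ := exists_lt_of_lt_ciSup (show ν.variation a / 2 < ν.variation a by linarith)
  have h1 := ν.map_finset_sup _ (P.supIndep.subset (Finset.filter_subset (fun b => 0 ≤ ν b) _))
  have h2 := ν.map_finset_sup _ (P.supIndep.subset (Finset.filter_subset (fun b => ¬ 0 ≤ ν b) _))
  have e1 : ∑ b ∈ P.parts with 0 ≤ ν b, |ν b| = ∑ b ∈ P.parts with 0 ≤ ν b, ν b :=
    Finset.sum_congr rfl fun b hb => abs_of_nonneg (Finset.mem_filter.1 hb).2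
  have e2 : ∑ b ∈ P.parts with ¬ 0 ≤ ν b, |ν b| = - ∑ b ∈ P.parts with ¬ 0 ≤ ν b, ν b := by
    rw [← Finset.sum_neg_distrib]
    exact Finset.sum_congr rfl fun b hb => abs_of_neg (not_le.1 (Finset.mem_filter.1 hb).2)
  rw [← Finset.sum_filter_add_sum_filter_not P.parts (fun b => 0 ≤ ν b), e1, e2, ← h1, ← h2] at hP
  have hle : ∀ s ⊆ P.parts, s.sup id ≤ a := fun s hs =>
    Finset.sup_le fun b hb => P.le (hs hb)
  by_contra! H
  have i1 := H _ (hle _ (Finset.filter_subset (fun b => 0 ≤ ν b) P.parts))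
  have i2 := H _ (hle _ (Finset.filter_subset (fun b => ¬ 0 ≤ ν b) P.parts))
  have j1 := le_abs_self (ν (({b ∈ P.parts | 0 ≤ ν b} : Finset A).sup id))
  have j2 := neg_le_abs (ν (({b ∈ P.parts | ¬ 0 ≤ ν b} : Finset A).sup id))
  linarith

/-- The charge `∑ₙ 2⁻ⁿ |νₙ|`, for a uniformly bounded sequence of charges: a control charge of the
sequence. -/
noncomputable def control (ν : ℕ → BoundedCharge A) (C : ℝ) (hC : ∀ n, ‖ν n‖ ≤ C) :
    BoundedCharge A :=
  have hs : ∀ a, Summable fun n => (1 / 2 : ℝ) ^ n * (ν n).variation a := fun a =>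
    Summable.of_nonneg_of_le (fun n => mul_nonneg (by positivity) ((ν n).variation_nonneg a))
      (fun n => mul_le_mul_of_nonneg_left (((ν n).variation_mono le_top).trans (hC n))
        (by positivity)) (summable_geometric_two.mul_right C)
  { toFun := fun a => ∑' n, (1 / 2 : ℝ) ^ n * (ν n).variation a
    map_sup' := fun a b h => by
      rw [← (hs a).tsum_add (hs b)]
      simp only [(ν _).variation_sup a b h, mul_add]
    bounded' := ⟨∑' n, (1 / 2 : ℝ) ^ n * C, fun a => by
      rw [abs_of_nonneg (tsum_nonneg fun n =>
        mul_nonneg (by positivity) ((ν n).variation_nonneg a))]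
      exact (hs a).tsum_le_tsum (fun n => mul_le_mul_of_nonneg_left
        (((ν n).variation_mono le_top).trans (hC n)) (by positivity))
        (summable_geometric_two.mul_right C)⟩ }

theorem control_nonneg (ν : ℕ → BoundedCharge A) (C : ℝ) (hC : ∀ n, ‖ν n‖ ≤ C) (a : A) :
    0 ≤ control ν C hC a :=
  tsum_nonneg fun n => mul_nonneg (by positivity) ((ν n).variation_nonneg a)

theorem variation_le_control (ν : ℕ → BoundedCharge A) (C : ℝ) (hC : ∀ n, ‖ν n‖ ≤ C) (n : ℕ)
    (a : A) : (ν n).variation a ≤ 2 ^ n * control ν C hC a := by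
  have hs : Summable fun n => (1 / 2 : ℝ) ^ n * (ν n).variation a :=
    Summable.of_nonneg_of_le (fun n => mul_nonneg (by positivity) ((ν n).variation_nonneg a))
      (fun n => mul_le_mul_of_nonneg_left (((ν n).variation_mono le_top).trans (hC n))
        (by positivity)) (summable_geometric_two.mul_right C)
  have := hs.le_tsum n fun m _ => mul_nonneg (by positivity) ((ν m).variation_nonneg a)
  have h2 : (1 / 2 : ℝ) ^ n * (ν n).variation a ≤ control ν C hC a := this
  calc (ν n).variation a = 2 ^ n * ((1 / 2 : ℝ) ^ n * (ν n).variation a) := by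
        rw [← mul_assoc, ← mul_pow]; norm_num
    _ ≤ _ := mul_le_mul_of_nonneg_left h2 (by positivity)

/-- A nonnegative charge is monotone. -/
theorem mono_of_nonneg {l : BoundedCharge A} (hl : ∀ a, 0 ≤ l a) {a b : A} (h : a ≤ b) :
    l a ≤ l b := by
  have := l.map_sup' a (b \ a) disjoint_sdiff_self_right
  rw [sup_sdiff_cancel_right h] at this
  linarith [hl (b \ a)]

theorem sup_le_of_nonneg {l : BoundedCharge A} (hl : ∀ a, 0 ≤ l a) (a b : A) :
    l (a ⊔ b) ≤ l a + l b := by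
  have := l.map_sup' a (b \ a) disjoint_sdiff_self_right
  rw [sup_sdiff_self_right] at this
  linarith [mono_of_nonneg hl (sdiff_le : b \ a ≤ b)]

end BoundedCharge

/-! ### Exhaustive submeasures -/

/-- A submeasure on a Boolean algebra: monotone, subadditive and zero at `⊥`. -/
structure IsSubmeasure {A : Type u} [BooleanAlgebra A] (m : A → ℝ) : Prop where
  map_bot : m ⊥ = 0
  mono : Monotone m
  sup_le : ∀ a b, m (a ⊔ b) ≤ m a + m b

/-- A set function is exhaustive if its values on an antichain never all stay above a positive
constant. Applied to subsequences, this says for `m ≥ 0` that `m` tends to `0` along antichains. -/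
def IsExhaustive {A : Type u} [BooleanAlgebra A] (m : A → ℝ) : Prop :=
  ∀ c : ℕ → A, IsBooleanAntichain c → ∀ η > 0, ∃ k, m (c k) < η

section Submeasure

variable {A : Type u} [BooleanAlgebra A] {m : A → ℝ}

theorem IsSubmeasure.finset_sup_le (hm : IsSubmeasure m) {ι : Type*} (s : Finset ι) (c : ι → A) :
    m (s.sup c) ≤ ∑ i ∈ s, m (c i) := by
  classical
  induction s using Finset.induction_on with
  | empty => simp [hm.map_bot]
  | insert i s hi ih =>
    rw [Finset.sup_insert, Finset.sum_insert hi]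
    exact (hm.sup_le _ _).trans (by linarith)

/-- Increasing sequences are Cauchy for an exhaustive set function, because otherwise the
differences along a subsequence form an antichain. -/
theorem IsExhaustive.cauchy_of_monotone (hm : IsExhaustive m) {w : ℕ → A} (hw : Monotone w)
    {η : ℝ} (hη : 0 < η) : ∃ k, ∀ l ≥ k, m (w l \ w k) < η := by
  by_contra! h
  choose next hle hnext using h
  let r : ℕ → ℕ := fun i => next^[i] 0
  have hr : ∀ i, r (i + 1) = next (r i) := fun i => Function.iterate_succ_apply' next i 0
  have hmono : Monotone r := monotone_nat_of_le_succ fun i => by rw [hr]; exact hle _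
  have hlt : ∀ i j, i < j → (w (r (i + 1)) \ w (r i)) ⊓ (w (r (j + 1)) \ w (r j)) = ⊥ := by
    intro i j hij
    have h1 : w (r (i + 1)) ≤ w (r j) := hw (hmono hij)
    exact (disjoint_sdiff_self_right.mono_left (sdiff_le.trans h1)).eq_bot
  obtain ⟨k, hk⟩ := hm (fun i => w (r (i + 1)) \ w (r i)) (fun i j hij => by
    rcases lt_or_gt_of_ne hij with h | h
    · exact hlt i j h
    · rw [inf_comm]; exact hlt j i h) η hη
  have := hnext (r k)
  rw [← hr] at this
  exact absurd hk (not_lt.2 this)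

theorem IsExhaustive.cauchy_of_antitone (hm : IsExhaustive m) {w : ℕ → A} (hw : Antitone w)
    {η : ℝ} (hη : 0 < η) : ∃ k, ∀ l ≥ k, m (w k \ w l) < η := by
  obtain ⟨k, hk⟩ := hm.cauchy_of_monotone (w := fun i => (w i)ᶜ)
    (fun i j h => compl_le_compl (hw h)) hη
  refine ⟨k, fun l hl => ?_⟩
  have := hk l hl
  rwa [compl_sdiff_compl] at this

/-- For an exhaustive submeasure, a sequence of elements of large submeasure can be replaced by a
decreasing one whose `k`-th term lies below a finite join of terms with indices `≥ k`. This makes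
up for the missing `limsup` in a Boolean algebra without infinite joins. -/
theorem IsExhaustive.exists_antitone (hm : IsExhaustive m) (hs : IsSubmeasure m) {a : ℕ → A}
    {δ : ℝ} (hδ : 0 < δ) (ha : ∀ k, δ ≤ m (a k)) :
    ∃ d : ℕ → A, Antitone d ∧ (∀ k, ∃ l, d k ≤ (Finset.range l).sup fun j => a (k + j)) ∧
      ∀ k, δ / 2 ≤ m (d k) := by
  -- `U k l` increases with `l`; stopping it at `l k`, where it is nearly constant for `m`, gives
  -- elements `s k` that are decreasing up to small submeasure; the meets of `s 0, …, s k` are the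
  -- required sequence
  let U : ℕ → ℕ → A := fun k l => (Finset.range (l + 1)).sup fun j => a (k + j)
  have hU : ∀ k, Monotone (U k) := fun k l l' h =>
    Finset.sup_mono (Finset.range_subset_range.2 (by omega))
  have hUU : ∀ j k l, j ≤ k → U k l ≤ U j (k - j + l) := by
    intro j k l hjk
    refine Finset.sup_le fun i hi => ?_
    have := Finset.le_sup (f := fun i => a (j + i)) (s := Finset.range (k - j + l + 1))
      (b := k - j + i) (by simp only [Finset.mem_range] at hi ⊢; omega)
    have e : j + (k - j + i) = k + i := by omega
    simpa only [e] using this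
  have hc : ∀ k, ∃ l, ∀ l' ≥ l, m (U k l' \ U k l) < δ / 4 * (1 / 2) ^ k := fun k =>
    hm.cauchy_of_monotone (hU k) (by positivity)
  choose l hl using hc
  let s : ℕ → A := fun k => U k (l k)
  refine ⟨fun k => (Finset.range (k + 1)).inf s, ?_, ?_, ?_⟩
  · intro k k' h
    exact Finset.inf_mono (Finset.range_subset_range.2 (by omega))
  · exact fun k => ⟨l k + 1, Finset.inf_le (f := s) (by simp)⟩
  · intro k
    have h1 : m (s k \ (Finset.range (k + 1)).inf s) ≤ δ / 2 := by
      rw [← Finset.sup_sdiff_left]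
      calc m ((Finset.range (k + 1)).sup fun j => s k \ s j)
          ≤ ∑ j ∈ Finset.range (k + 1), m (s k \ s j) := hs.finset_sup_le _ _
        _ ≤ ∑ j ∈ Finset.range (k + 1), δ / 4 * (1 / 2) ^ j := by
            refine Finset.sum_le_sum fun j hj => ?_
            have hjk : j ≤ k := by simp only [Finset.mem_range] at hj; omega
            refine (hs.mono (sdiff_le_sdiff_right ?_)).trans
              (hl j (max (k - j + l k) (l j)) (le_max_right _ _)).le
            exact (hUU j k (l k) hjk).trans (hU j (le_max_left _ _))
        _ ≤ δ / 4 * 2 := by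
            rw [← Finset.mul_sum]
            exact mul_le_mul_of_nonneg_left (sum_geometric_two_le _) (by positivity)
        _ = δ / 2 := by ring
    have h2 : a k ≤ s k := by
      have := Finset.le_sup (f := fun j => a (k + j)) (s := Finset.range (l k + 1)) (b := 0)
        (by simp)
      simpa using this
    have h3 : m (s k) ≤ m ((Finset.range (k + 1)).inf s) +
        m (s k \ (Finset.range (k + 1)).inf s) := by
      refine le_trans (hs.mono ?_) (hs.sup_le _ _)
      rw [sup_sdiff_self_right]
      exact le_sup_right
    linarith [ha k, hs.mono h2]

end Submeasure

namespace BoundedCharge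

variable {A : Type u} [BooleanAlgebra A]

/-- If a uniformly bounded sequence of charges is not uniformly absolutely continuous with respect
to its control charge, then it is not uniformly exhaustive. -/
theorem exists_antichain_of_control (ν : ℕ → BoundedCharge A) {C : ℝ} (hC : ∀ n, ‖ν n‖ ≤ C)
    {δ : ℝ} (hδ : 0 < δ)
    (h : ∀ κ > 0, ∃ a n, control ν C hC a < κ ∧ δ ≤ (ν n).variation a) :
    ∃ c : ℕ → A, IsBooleanAntichain c ∧ ∃ η > 0, ∃ n : ℕ → ℕ,
      ∀ k, η ≤ (ν (n k)).variation (c k) := by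
  let m : A → ℝ := fun a => ⨆ n, (ν n).variation a
  have hbdd : ∀ a, BddAbove (Set.range fun n => (ν n).variation a) := fun a =>
    ⟨C, by rintro _ ⟨n, rfl⟩; exact ((ν n).variation_mono le_top).trans (hC n)⟩
  have hle : ∀ n a, (ν n).variation a ≤ m a := fun n a => le_ciSup (hbdd a) n
  have hm : IsSubmeasure m := by
    refine ⟨?_, ?_, ?_⟩
    · have : ∀ n, (ν n).variation ⊥ = 0 := fun n => (ν n).variationCharge.map_bot
      simp [m, this]
    · exact fun a b hab => ciSup_le fun n => ((ν n).variation_mono hab).trans (hle n b)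
    · exact fun a b => ciSup_le fun n =>
        (sup_le_of_nonneg (l := (ν n).variationCharge) (ν n).variation_nonneg a b).trans
          (add_le_add (hle n a) (hle n b))
  by_cases hex : IsExhaustive m
  · exfalso
    choose a i hai hi using fun k : ℕ => h ((1 / 2 : ℝ) ^ k) (by positivity)
    obtain ⟨d, hd, hda, hdm⟩ := hex.exists_antitone hm hδ fun k => (hi k).trans (hle _ _)
    have hl := control_nonneg ν C hC
    have hlam : ∀ k, control ν C hC (d k) ≤ 2 * (1 / 2) ^ k := by
      intro k
      obtain ⟨l, hkl⟩ := hda k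
      have hsub : IsSubmeasure (control ν C hC) :=
        ⟨(control ν C hC).map_bot, fun _ _ => mono_of_nonneg hl, sup_le_of_nonneg hl⟩
      calc control ν C hC (d k) ≤ ∑ j ∈ Finset.range l, control ν C hC (a (k + j)) :=
            (hsub.mono hkl).trans (hsub.finset_sup_le _ _)
        _ ≤ ∑ j ∈ Finset.range l, (1 / 2 : ℝ) ^ k * (1 / 2) ^ j := by
            refine Finset.sum_le_sum fun j _ => ?_
            rw [← pow_add]
            exact (hai _).le
        _ ≤ 2 * (1 / 2) ^ k := by
            rw [← Finset.mul_sum, mul_comm]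
            exact mul_le_mul_of_nonneg_right (sum_geometric_two_le _) (by positivity)
    obtain ⟨K, hK⟩ := hex.cauchy_of_antitone hd (show 0 < δ / 4 by positivity)
    -- for fixed `n`, the variation of `d l` tends to `0`, so `d K` is bounded by the differences
    have hfin : m (d K) ≤ δ / 4 := by
      refine ciSup_le fun n => ?_
      have hlim : Tendsto (fun l : ℕ => (2 : ℝ) ^ n * (2 * (1 / 2) ^ l) + δ / 4) atTop
          (𝓝 (2 ^ n * (2 * 0) + δ / 4)) :=
        (((tendsto_pow_atTop_nhds_zero_of_lt_one (by norm_num) (by norm_num)).const_mul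
          2).const_mul _).add_const _
      rw [mul_zero, mul_zero, zero_add] at hlim
      refine ge_of_tendsto hlim ?_
      filter_upwards [eventually_ge_atTop K] with l hKl
      have h1 : (ν n).variation (d K) = (ν n).variation (d l) + (ν n).variation (d K \ d l) := by
        rw [← variation_sup _ _ _ disjoint_sdiff_self_right, sup_sdiff_cancel_right (hd hKl)]
      have h2 := variation_le_control ν C hC n (d l)
      have h3 : (2 : ℝ) ^ n * control ν C hC (d l) ≤ 2 ^ n * (2 * (1 / 2) ^ l) :=
        mul_le_mul_of_nonneg_left (hlam l) (by positivity)
      linarith [hle n (d K \ d l), hK l hKl]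
    linarith [hdm K]
  · simp only [IsExhaustive, not_forall, not_exists, not_lt] at hex
    obtain ⟨c, hc, η, hη, hcη⟩ := hex
    have : ∀ k, ∃ n, η / 2 < (ν n).variation (c k) := fun k =>
      exists_lt_of_lt_ciSup (show η / 2 < m (c k) by linarith [hcη k])
    choose n hn using this
    exact ⟨c, hc, η / 2, by positivity, n, fun k => (hn k).le⟩

/-- Since the variation of each charge sums to at most its norm along an antichain, a sequence of
charges that are large on the successive terms of an antichain takes each value only finitely
often. -/
theorem tendsto_atTop_of_le_variation (ν : ℕ → BoundedCharge A) {c : ℕ → A}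
    (hc : IsBooleanAntichain c) {η : ℝ} (hη : 0 < η) {n : ℕ → ℕ}
    (h : ∀ k, η ≤ (ν (n k)).variation (c k)) : Tendsto n atTop atTop := by
  rw [← Nat.cofinite_eq_atTop]
  refine Tendsto.cofinite_of_finite_preimage_singleton fun N => ?_
  by_contra hinf
  obtain ⟨M, hM⟩ := exists_nat_gt ((ν N).variation ⊤ / η)
  obtain ⟨s, hs, hcard⟩ := (Set.not_finite.1 hinf).exists_subset_card_eq M
  have h1 := (ν N).variationCharge.sum_disjoint s c fun i _ j _ hij =>
    disjoint_iff.2 (hc i j hij)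
  have h2 : ∑ i ∈ s, η ≤ ∑ i ∈ s, (ν N).variationCharge (c i) := by
    refine Finset.sum_le_sum fun i hi => ?_
    have hi' : n i = N := hs hi
    have := h i
    rwa [hi'] at this
  rw [← h1, Finset.sum_const, hcard, nsmul_eq_mul] at h2
  have h3 := (ν N).variation_mono (le_top : s.sup c ≤ ⊤)
  rw [div_lt_iff₀ hη] at hM
  exact absurd (h2.trans h3) (not_le.2 hM)

end BoundedCharge

/-! ### Stone spaces and step functions -/

namespace StoneSpace

variable {A : Type u} [BooleanAlgebra A]

theorem exists_mem {a : A} (ha : a ≠ ⊥) : ∃ x : StoneSpace A, a ∈ x.carrier := by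
  have hdisj : Disjoint ((Order.PFilter.principal a : Order.PFilter A) : Set A)
      ((Order.Ideal.principal ⊥ : Order.Ideal A) : Set A) := by
    rw [Set.disjoint_left]
    intro b hb hb'
    have h1 : a ≤ b := by simpa using hb
    have h2 : b ≤ ⊥ := hb'
    exact ha (le_bot_iff.1 (h1.trans h2))
  obtain ⟨J, hJ, -, hd⟩ := DistribLattice.prime_ideal_of_disjoint_filter_ideal hdisj
  have haJ : a ∉ J := fun h => Set.disjoint_left.1 hd (by simp) h
  refine ⟨⟨{b | b ∉ J}, ?_, ?_, ?_, ?_, ?_⟩, haJ⟩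
  · exact fun h => haJ (J.lower le_top h)
  · exact fun h => h J.bot_mem
  · exact fun hab h h' => h (J.lower hab h')
  · exact fun h h' h'' => (hJ.mem_or_mem h'').elim h h'
  · intro b
    by_contra! hb
    simp only [Set.mem_ofPred_eq, not_not] at hb
    refine haJ (J.lower le_top (?_ : (⊤ : A) ∈ J))
    rw [← sup_compl_eq_top (x := b)]
    exact Order.Ideal.sup_mem hb.1 hb.2

theorem notMem_of_disjoint {x : StoneSpace A} {a b : A} (h : Disjoint a b) (ha : a ∈ x.carrier) :
    b ∉ x.carrier := fun hb => x.bot_notMem (h.eq_bot ▸ x.inf_mem ha hb)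

theorem mem_finset_sup {x : StoneSpace A} {ι : Type*} {s : Finset ι} {c : ι → A} :
    s.sup c ∈ x.carrier ↔ ∃ i ∈ s, c i ∈ x.carrier := by
  classical
  induction s using Finset.induction_on with
  | empty => simpa using x.bot_notMem
  | insert i s hi ih =>
    rw [Finset.sup_insert, Finset.exists_mem_insert, ← ih]
    constructor
    · intro h
      by_contra! hn
      have h1 := x.inf_mem ((x.compl_mem_iff _).2 hn.1) ((x.compl_mem_iff _).2 hn.2)
      rw [← compl_sup] at h1
      exact (x.compl_mem_iff _).1 h1 h
    · rintro (h | h)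
      · exact x.mem_of_le le_sup_left h
      · exact x.mem_of_le le_sup_right h

theorem exists_part_mem (P : Finpartition (⊤ : A)) (x : StoneSpace A) :
    ∃ b ∈ P.parts, b ∈ x.carrier := by
  have h := x.top_mem
  rw [← P.sup_parts] at h
  exact mem_finset_sup.1 h

theorem isClopen_basicSet (a : A) : IsClopen (basicSet a) := by
  refine ⟨⟨?_⟩, isOpen_basicSet a⟩
  convert isOpen_basicSet aᶜ using 1
  ext x
  exact (x.compl_mem_iff a).symm

/-- The indicator function of the clopen set `[a]`, as an element of `C(St(A))`. -/
noncomputable def ind (a : A) : C(StoneSpace A, ℝ) :=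
  (LocallyConstant.charFn ℝ (isClopen_basicSet a)).toContinuousMap

theorem ind_of_mem {a : A} {x : StoneSpace A} (h : a ∈ x.carrier) : ind a x = 1 := by
  have : x ∈ basicSet a := h
  simp [ind, LocallyConstant.coe_charFn, this]

theorem ind_of_notMem {a : A} {x : StoneSpace A} (h : a ∉ x.carrier) : ind a x = 0 := by
  have : x ∉ basicSet a := h
  simp [ind, LocallyConstant.coe_charFn, this]

theorem exists_finpartition_le_or_le_compl (a : A) :
    ∃ P : Finpartition (⊤ : A), ∀ b ∈ P.parts, b ≤ a ∨ b ≤ aᶜ := by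
  classical
  have hd : ((({a, aᶜ} : Finset A)) : Set A).PairwiseDisjoint id := by
    intro i hi j hj hij
    simp only [Finset.coe_insert, Finset.coe_singleton, Set.mem_insert_iff,
      Set.mem_singleton_iff] at hi hj
    rcases hi with rfl | rfl <;> rcases hj with rfl | rfl
    · exact (hij rfl).elim
    · exact disjoint_compl_right
    · exact disjoint_compl_left
    · exact (hij rfl).elim
  refine ⟨(Finpartition.ofPairwiseDisjoint {a, aᶜ} hd).copy (by simp), fun b hb => ?_⟩
  simp only [Finpartition.copy_parts, Finpartition.ofPairwiseDisjoint_parts, Finset.mem_erase,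
    Finset.mem_insert, Finset.mem_singleton] at hb
  rcases hb.2 with rfl | rfl
  · exact Or.inl le_rfl
  · exact Or.inr le_rfl

theorem isTopologicalBasis_range_basicSet :
    TopologicalSpace.IsTopologicalBasis (Set.range (basicSet (A := A))) := by
  refine TopologicalSpace.isTopologicalBasis_of_subbasis_of_finiteInter rfl ⟨?_, ?_⟩
  · exact ⟨⊤, Set.eq_univ_of_forall fun x => x.top_mem⟩
  · rintro _ ⟨a, rfl⟩ _ ⟨b, rfl⟩
    refine ⟨a ⊓ b, ?_⟩
    ext x
    exact ⟨fun h => ⟨x.mem_of_le inf_le_left h, x.mem_of_le inf_le_right h⟩,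
      fun h => x.inf_mem h.1 h.2⟩

/-- Every continuous function on the Stone space oscillates by at most `τ` on the parts of some
finite partition. -/
theorem exists_finpartition_abs_sub_le (f : C(StoneSpace A, ℝ)) {τ : ℝ} (hτ : 0 < τ) :
    ∃ P : Finpartition (⊤ : A), ∀ b ∈ P.parts, ∀ x y : StoneSpace A, b ∈ x.carrier →
      b ∈ y.carrier → |f x - f y| ≤ τ := by
  classical
  have hx : ∀ x : StoneSpace A, ∃ a : A, a ∈ x.carrier ∧
      ∀ y : StoneSpace A, a ∈ y.carrier → |f y - f x| < τ / 2 := by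
    intro x
    have hopen : IsOpen (f ⁻¹' Metric.ball (f x) (τ / 2)) :=
      Metric.isOpen_ball.preimage f.continuous
    obtain ⟨_, ⟨a, rfl⟩, hxa, ha⟩ := isTopologicalBasis_range_basicSet.exists_subset_of_mem_open
      (show x ∈ f ⁻¹' Metric.ball (f x) (τ / 2) by simpa using hτ) hopen
    refine ⟨a, hxa, fun y hy => ?_⟩
    simpa [Real.dist_eq] using ha hy
  choose a hxa ha using hx
  obtain ⟨t, ht⟩ := isCompact_univ.elim_finite_subcover (fun x => basicSet (a x))
    (fun x => isOpen_basicSet _) (fun x _ => Set.mem_iUnion.2 ⟨x, hxa x⟩)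
  have hP : ∃ P : Finpartition (⊤ : A), ∀ x ∈ t, ∀ b ∈ P.parts, b ≤ a x ∨ b ≤ (a x)ᶜ := by
    clear ht
    induction t using Finset.induction_on with
    | empty => exact ⟨Classical.arbitrary _, by simp⟩
    | insert x t _ ih =>
      obtain ⟨P, hP⟩ := ih
      obtain ⟨Q, hQ⟩ := exists_finpartition_le_or_le_compl (a x)
      refine ⟨P ⊓ Q, fun y hy b hb => ?_⟩
      rcases Finset.mem_insert.1 hy with rfl | hy
      · obtain ⟨c, hc, hbc⟩ := (inf_le_right : P ⊓ Q ≤ Q) hb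
        exact (hQ c hc).imp hbc.trans hbc.trans
      · obtain ⟨c, hc, hbc⟩ := (inf_le_left : P ⊓ Q ≤ P) hb
        exact (hP y hy c hc).imp hbc.trans hbc.trans
  obtain ⟨P, hP⟩ := hP
  refine ⟨P, fun b hb x y hbx hby => ?_⟩
  obtain ⟨z, hz, hxz⟩ := Set.mem_iUnion₂.1 (ht (Set.mem_univ x))
  have hbz : b ≤ a z := (hP z hz b hb).resolve_right fun h =>
    (x.compl_mem_iff _).1 (x.mem_of_le h hbx) hxz
  have h1 := ha z x (x.mem_of_le hbz hbx)
  have h2 := ha z y (y.mem_of_le hbz hby)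
  rw [abs_lt] at h1 h2
  rw [abs_le]
  constructor <;> linarith

/-- The value of a function at some chosen point of `[b]`, and the junk value `0` if `b = ⊥`. -/
noncomputable def sample (b : A) : C(StoneSpace A, ℝ) →ₗ[ℝ] ℝ := by
  classical exact
  if h : ∃ x : StoneSpace A, b ∈ x.carrier then (ContinuousMap.evalCLM ℝ h.choose).toLinearMap
  else 0

theorem exists_sample_eq {b : A} (hb : b ≠ ⊥) :
    ∃ x : StoneSpace A, b ∈ x.carrier ∧ ∀ f : C(StoneSpace A, ℝ), sample b f = f x := by
  have h := exists_mem hb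
  refine ⟨h.choose, h.choose_spec, fun f => ?_⟩
  simp [sample, h]

theorem abs_sample_le (b : A) (f : C(StoneSpace A, ℝ)) : |sample b f| ≤ ‖f‖ := by
  by_cases h : ∃ x : StoneSpace A, b ∈ x.carrier
  · simpa [sample, h] using f.norm_coe_le_norm h.choose
  · simp [sample, h]

/-- The step function approximating `f` along a finite partition. -/
noncomputable def step (P : Finpartition (⊤ : A)) (f : C(StoneSpace A, ℝ)) :
    C(StoneSpace A, ℝ) :=
  ∑ b ∈ P.parts, sample b f • ind b

/-- On the clopen set of one member of a disjoint family, a linear combination of the indicators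
takes the corresponding coefficient as its value. -/
theorem sum_smul_ind_apply {ι : Type*} {s : Finset ι} {c : ι → A} (w : ι → ℝ)
    (hd : (s : Set ι).PairwiseDisjoint c) {i : ι} (hi : i ∈ s) {x : StoneSpace A}
    (hx : c i ∈ x.carrier) : (∑ j ∈ s, w j • ind (c j)) x = w i := by
  rw [ContinuousMap.sum_apply, Finset.sum_eq_single_of_mem i hi]
  · simp [ind_of_mem hx]
  · intro j hj hji
    have := notMem_of_disjoint (hd hi hj hji.symm) hx
    simp [ind_of_notMem this]

theorem norm_sub_step_le {f : C(StoneSpace A, ℝ)} {P : Finpartition (⊤ : A)} {τ : ℝ}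
    (hτ : 0 ≤ τ) (h : ∀ b ∈ P.parts, ∀ x y : StoneSpace A, b ∈ x.carrier →
      b ∈ y.carrier → |f x - f y| ≤ τ) : ‖f - step P f‖ ≤ τ := by
  rw [ContinuousMap.norm_le _ hτ]
  intro x
  obtain ⟨b, hb, hx⟩ := exists_part_mem P x
  obtain ⟨y, hy, hs⟩ := exists_sample_eq (P.ne_bot hb)
  have : step P f x = f y := by
    rw [← hs]
    exact sum_smul_ind_apply (c := id) _ P.disjoint hb hx
  rw [ContinuousMap.sub_apply, this]
  exact h b hb x y hx hy

/-- Testing a functional against `∑ ± 1_{[cᵢ]}`, which has norm at most one. -/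
theorem sum_abs_apply_ind_le (h : StrongDual ℝ C(StoneSpace A, ℝ)) {ι : Type*} (s : Finset ι)
    (c : ι → A) (hd : (s : Set ι).PairwiseDisjoint c) : ∑ i ∈ s, |h (ind (c i))| ≤ ‖h‖ := by
  let w : ι → ℝ := fun i => SignType.sign (h (ind (c i)))
  have h1 : ∑ i ∈ s, |h (ind (c i))| = h (∑ i ∈ s, w i • ind (c i)) := by
    simp only [map_sum, map_smul, smul_eq_mul, w, sign_mul_self]
  have h2 : ‖∑ i ∈ s, w i • ind (c i)‖ ≤ 1 := by
    rw [ContinuousMap.norm_le _ zero_le_one]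
    intro x
    by_cases hx : ∃ i ∈ s, c i ∈ x.carrier
    · obtain ⟨i, hi, hx⟩ := hx
      rw [sum_smul_ind_apply w hd hi hx]
      rcases lt_trichotomy (h (ind (c i))) 0 with h0 | h0 | h0 <;> simp [w, h0]
    · push Not at hx
      rw [ContinuousMap.sum_apply, Finset.sum_eq_zero]
      · simp
      · intro i hi
        simp [ind_of_notMem (hx i hi)]
  rw [h1]
  calc h (∑ i ∈ s, w i • ind (c i)) ≤ ‖h‖ * ‖∑ i ∈ s, w i • ind (c i)‖ :=
        (le_abs_self _).trans (h.le_opNorm _)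
    _ ≤ ‖h‖ := mul_le_of_le_one_right (norm_nonneg h) h2

end StoneSpace

/-! ### Charges and functionals -/

open StoneSpace

namespace BoundedCharge

variable {A : Type u} [BooleanAlgebra A]

/-- The charge `a ↦ h(1_{[a]})` of a functional `h` on `C(St(A))`. -/
noncomputable def ofDual (h : StrongDual ℝ C(StoneSpace A, ℝ)) : BoundedCharge A where
  toFun a := h (ind a)
  map_sup' a b hab := by
    rw [← map_add]
    congr 1
    ext x
    rw [ContinuousMap.add_apply]
    by_cases ha : a ∈ x.carrier
    · rw [ind_of_mem ha, ind_of_notMem (notMem_of_disjoint hab ha),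
        ind_of_mem (x.mem_of_le le_sup_left ha), add_zero]
    · by_cases hb : b ∈ x.carrier
      · rw [ind_of_notMem ha, ind_of_mem hb, ind_of_mem (x.mem_of_le le_sup_right hb), zero_add]
      · rw [ind_of_notMem ha, ind_of_notMem hb, ind_of_notMem, add_zero]
        intro h
        have h1 := x.inf_mem ((x.compl_mem_iff _).2 ha) ((x.compl_mem_iff _).2 hb)
        rw [← compl_sup] at h1
        exact (x.compl_mem_iff _).1 h1 h
  bounded' := ⟨‖h‖, fun a => by
    simpa using sum_abs_apply_ind_le h (Finset.univ : Finset Unit) (fun _ => a)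
      (by intro i _ j _ h; exact (h rfl).elim)⟩

theorem norm_ofDual_le (h : StrongDual ℝ C(StoneSpace A, ℝ)) : ‖ofDual h‖ ≤ ‖h‖ :=
  variation_le fun P => sum_abs_apply_ind_le h P.parts id P.disjoint

/-- Every bounded charge comes from a functional, integration against the charge. It is obtained as
the limit of Riemann sums along an ultrafilter refining all finite partitions, so that linearity and
the bounds pass to the limit and no convergence of the sums has to be shown. -/
theorem exists_dual (ν : BoundedCharge A) : ∃ T : StrongDual ℝ C(StoneSpace A, ℝ),
    (∀ a, T (ind a) = ν a) ∧ ‖T‖ ≤ ‖ν‖ ∧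
      ((∀ a, 0 ≤ ν a) → ∀ f : C(StoneSpace A, ℝ), (∀ x, 0 ≤ f x) → 0 ≤ T f) := by
  classical
  let R : Finpartition (⊤ : A) → C(StoneSpace A, ℝ) →ₗ[ℝ] ℝ := fun P =>
    ∑ b ∈ P.parts, ν b • sample b
  have hR : ∀ P f, R P f = ∑ b ∈ P.parts, ν b * sample b f := fun P f => by
    simp [R, LinearMap.sum_apply]
  have hRle : ∀ P f, |R P f| ≤ ‖ν‖ * ‖f‖ := by
    intro P f
    calc |R P f| ≤ ∑ b ∈ P.parts, |ν b| * ‖f‖ := by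
          rw [hR]
          refine (Finset.abs_sum_le_sum_abs _ _).trans (Finset.sum_le_sum fun b _ => ?_)
          rw [abs_mul]
          exact mul_le_mul_of_nonneg_left (abs_sample_le b f) (abs_nonneg _)
      _ ≤ ‖ν‖ * ‖f‖ := by
          rw [← Finset.sum_mul]
          exact mul_le_mul_of_nonneg_right (le_ciSup (ν.bddAbove_variation ⊤) P) (norm_nonneg _)
  let V : Ultrafilter (Finpartition (⊤ : A)) := Ultrafilter.of atBot
  have hV : (V : Filter (Finpartition (⊤ : A))) ≤ atBot := Ultrafilter.of_le atBot
  have hlim : ∀ f, ∃ L, Tendsto (fun P => R P f) V (𝓝 L) := by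
    intro f
    obtain ⟨L, -, hL⟩ := (isCompact_Icc (a := -(‖ν‖ * ‖f‖)) (b := ‖ν‖ * ‖f‖)).ultrafilter_le_nhds
      (V.map fun P => R P f) (by
        rw [le_principal_iff, Ultrafilter.mem_coe, Ultrafilter.mem_map]
        exact Filter.mem_of_superset Filter.univ_mem fun P _ => abs_le.1 (hRle P f))
    exact ⟨L, hL⟩
  choose T hT using hlim
  let T₀ : C(StoneSpace A, ℝ) →ₗ[ℝ] ℝ :=
    { toFun := T
      map_add' := fun f g => tendsto_nhds_unique (hT (f + g)) (by
        simpa only [map_add] using (hT f).add (hT g))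
      map_smul' := fun c f => tendsto_nhds_unique (hT (c • f)) (by
        simpa only [map_smul, RingHom.id_apply] using (hT f).const_smul c) }
  have hT₀ : ∀ f, ‖T₀ f‖ ≤ ‖ν‖ * ‖f‖ := fun f =>
    le_of_tendsto (hT f).abs (Eventually.of_forall fun P => hRle P f)
  have hν : 0 ≤ ‖ν‖ := ν.variation_nonneg ⊤
  refine ⟨T₀.mkContinuous ‖ν‖ hT₀, fun a => ?_, T₀.mkContinuous_norm_le hν hT₀, fun hpos f hf => ?_⟩
  · obtain ⟨P, hP⟩ := exists_finpartition_le_or_le_compl a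
    refine tendsto_nhds_unique (hT (ind a)) (tendsto_const_nhds.congr' ?_)
    filter_upwards [hV (eventually_le_atBot P)] with Q hQ
    have hsum : ∀ b ∈ Q.parts, ν b * sample b (ind a) = ν (b ⊓ a) := by
      intro b hb
      obtain ⟨c, hc, hbc⟩ := hQ hb
      obtain ⟨x, hx, hs⟩ := exists_sample_eq (Q.ne_bot hb)
      rw [hs]
      rcases hP c hc with h | h
      · rw [ind_of_mem (x.mem_of_le (hbc.trans h) hx), inf_eq_left.2 (hbc.trans h), mul_one]
      · have : Disjoint b a := le_compl_iff_disjoint_right.1 (hbc.trans h)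
        rw [ind_of_notMem (notMem_of_disjoint this hx), this.eq_bot, ν.map_bot, mul_zero]
    rw [hR, Finset.sum_congr rfl hsum, ← ν.sum_disjoint Q.parts (fun b => b ⊓ a)
      fun i hi j hj hij => (Q.disjoint hi hj hij).mono inf_le_left inf_le_left,
      ← Finset.sup_inf_distrib_right]
    have := Q.sup_parts
    change ν a = ν (Q.parts.sup id ⊓ a)
    rw [this, top_inf_eq]
  · refine ge_of_tendsto' (hT f) fun P => ?_
    rw [hR]
    refine Finset.sum_nonneg fun b hb => mul_nonneg (hpos b) ?_
    obtain ⟨x, -, hs⟩ := exists_sample_eq (P.ne_bot hb)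
    rw [hs]
    exact hf x

end BoundedCharge

section Dual

variable {A : Type u} [BooleanAlgebra A]

/-- A bounded sequence of functionals that converges on the indicators of clopen sets converges
pointwise. -/
theorem exists_dual_tendsto {h : ℕ → StrongDual ℝ C(StoneSpace A, ℝ)} {C : ℝ}
    (hC : ∀ n, ‖h n‖ ≤ C) (hconv : ∀ a : A, ∃ L, Tendsto (fun n => h n (ind a)) atTop (𝓝 L)) :
    ∃ g : StrongDual ℝ C(StoneSpace A, ℝ), ∀ f, Tendsto (fun n => h n f) atTop (𝓝 (g f)) := by
  have hC0 : 0 ≤ C := (norm_nonneg (h 0)).trans (hC 0)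
  have key : ∀ f, ∃ L, Tendsto (fun n => h n f) atTop (𝓝 L) := by
    intro f
    apply cauchySeq_tendsto_of_complete
    rw [Metric.cauchySeq_iff']
    intro ε hε
    obtain ⟨P, hP⟩ := exists_finpartition_abs_sub_le f (show 0 < ε / (4 * (C + 1)) by positivity)
    have hstep := norm_sub_step_le (by positivity) hP
    have hs : ∃ L, Tendsto (fun n => h n (step P f)) atTop (𝓝 L) := by
      choose L hL using hconv
      refine ⟨∑ b ∈ P.parts, sample b f * L b, ?_⟩
      simp only [step, map_sum, map_smul, smul_eq_mul]
      exact tendsto_finsetSum _ fun b _ => (hL b).const_mul _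
    obtain ⟨L, hL⟩ := hs
    obtain ⟨N, hN⟩ := Metric.cauchySeq_iff'.1 hL.cauchySeq (ε / 2) (by positivity)
    have hdiff : ∀ n, |h n f - h n (step P f)| ≤ ε / 4 := by
      intro n
      rw [← map_sub]
      calc |h n (f - step P f)| ≤ ‖h n‖ * ‖f - step P f‖ := (h n).le_opNorm _
        _ ≤ (C + 1) * (ε / (4 * (C + 1))) :=
            mul_le_mul ((hC n).trans (by linarith)) hstep (norm_nonneg _) (by positivity)
        _ = ε / 4 := by field_simp
    refine ⟨N, fun n hn => ?_⟩
    have h1 := hN n hn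
    have h2 := hdiff n
    have h3 := hdiff N
    rw [Real.dist_eq] at h1 ⊢
    rw [abs_lt] at h1 ⊢
    rw [abs_le] at h2 h3
    constructor <;> linarith
  choose g hg using key
  exact ⟨continuousLinearMapOfTendsto h (tendsto_pi_nhds.2 hg), hg⟩

/-- The value of a functional at `f` is controlled by the variation of its charge on a clopen set
on which `|f| ≥ τ`. -/
theorem exists_abs_apply_le (h : StrongDual ℝ C(StoneSpace A, ℝ)) (f : C(StoneSpace A, ℝ)) {τ : ℝ}
    (hτ : 0 < τ) : ∃ e : A, (∀ x : StoneSpace A, e ∈ x.carrier → τ ≤ |f x|) ∧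
      |h f| ≤ ‖f‖ * (BoundedCharge.ofDual h).variation e + 3 * τ * ‖h‖ := by
  classical
  obtain ⟨P, hP⟩ := exists_finpartition_abs_sub_le f hτ
  -- the threshold is `2 * τ` because the sampled values are off by up to `τ`
  let B := P.parts.filter fun b => 2 * τ ≤ |sample b f|
  refine ⟨B.sup id, fun x hx => ?_, ?_⟩
  · obtain ⟨b, hb, hbx⟩ := mem_finset_sup.1 hx
    obtain ⟨hbP, hb2⟩ := Finset.mem_filter.1 hb
    obtain ⟨y, hy, hs⟩ := exists_sample_eq (P.ne_bot hbP)
    rw [hs] at hb2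
    have h1 := hP b hbP y x hy hbx
    have h2 := abs_sub_abs_le_abs_sub (f y) (f x)
    linarith
  · have h1 : |h (f - step P f)| ≤ τ * ‖h‖ := by
      rw [mul_comm]
      exact (h.le_opNorm _).trans
        (mul_le_mul_of_nonneg_left (norm_sub_step_le hτ.le hP) (norm_nonneg _))
    have h2 : |h (step P f)| ≤ ‖f‖ * (BoundedCharge.ofDual h).variation (B.sup id) +
        2 * τ * ‖h‖ := by
      calc |h (step P f)| ≤ ∑ b ∈ P.parts, |sample b f| * |h (ind b)| := by
            simp only [step, map_sum, map_smul, smul_eq_mul]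
            refine (Finset.abs_sum_le_sum_abs _ _).trans_eq ?_
            simp only [abs_mul]
        _ = ∑ b ∈ B, |sample b f| * |h (ind b)| +
              ∑ b ∈ P.parts with ¬ 2 * τ ≤ |sample b f|, |sample b f| * |h (ind b)| :=
            (Finset.sum_filter_add_sum_filter_not _ _ _).symm
        _ ≤ ∑ b ∈ B, ‖f‖ * |h (ind b)| +
              ∑ b ∈ P.parts with ¬ 2 * τ ≤ |sample b f|, 2 * τ * |h (ind b)| := by
            refine add_le_add (Finset.sum_le_sum fun b _ => ?_) (Finset.sum_le_sum fun b hb => ?_)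
            · exact mul_le_mul_of_nonneg_right (abs_sample_le b f) (abs_nonneg _)
            · exact mul_le_mul_of_nonneg_right (not_le.1 (Finset.mem_filter.1 hb).2).le
                (abs_nonneg _)
        _ ≤ _ := by
            rw [← Finset.mul_sum, ← Finset.mul_sum]
            refine add_le_add (mul_le_mul_of_nonneg_left ?_ (norm_nonneg _))
              (mul_le_mul_of_nonneg_left ?_ (by positivity))
            · exact (BoundedCharge.ofDual h).sum_abs_le_variation B id
                (P.disjoint.subset (Finset.coe_subset.2 (Finset.filter_subset _ _)))
                fun b hb => Finset.le_sup (f := id) hb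
            · exact sum_abs_apply_ind_le h _ id (P.disjoint.subset
                (Finset.coe_subset.2 (Finset.filter_subset _ _)))
    have h3 : h f = h (f - step P f) + h (step P f) := by rw [map_sub]; ring
    rw [h3]
    linarith [abs_add_le (h (f - step P f)) (h (step P f))]

end Dual

/-! ### Weakly convergent sequences of charges along an antichain -/

/-- A gliding hump argument, the heart of Schur's theorem on `ℓ¹`: if all subseries of the rows of
a matrix with rows in `ℓ¹` tend to `0`, then so does the diagonal. -/
theorem tendsto_diag_of_tendsto_tsum_indicator {x : ℕ → ℕ → ℝ}
    (hs : ∀ n, Summable fun k => |x n k|)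
    (h : ∀ M : Set ℕ, Tendsto (fun n => ∑' k, M.indicator (x n) k) atTop (𝓝 0)) :
    Tendsto (fun n => x n n) atTop (𝓝 0) := by
  classical
  by_contra hcon
  rw [Metric.tendsto_atTop] at hcon
  push Not at hcon
  obtain ⟨δ, hδ, hfreq⟩ := hcon
  simp only [dist_zero_right, Real.norm_eq_abs] at hfreq
  have hcol : ∀ k, Tendsto (fun n => x n k) atTop (𝓝 0) := by
    intro k
    convert h {k} using 2 with n
    rw [tsum_eq_single k fun j hj => by simp [hj]]
    simp
  -- the hump `b` following `a`: row `b` is small up to column `a`, row `a` from column `b` on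
  have hstep : ∀ a, ∃ b, a < b ∧ δ ≤ |x b b| ∧ ∑ k ∈ Finset.range (a + 1), |x b k| < δ / 4 ∧
      ∑' k, |x a (k + b)| < δ / 4 := by
    intro a
    have h1 : ∀ᶠ b in atTop, ∑ k ∈ Finset.range (a + 1), |x b k| < δ / 4 := by
      have : Tendsto (fun b => ∑ k ∈ Finset.range (a + 1), |x b k|) atTop
          (𝓝 (∑ k ∈ Finset.range (a + 1), |(0 : ℝ)|)) :=
        tendsto_finsetSum _ fun k _ => (hcol k).abs
      refine this.eventually_lt_const ?_
      simpa using hδ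
    have h2 : ∀ᶠ b in atTop, ∑' k, |x a (k + b)| < δ / 4 :=
      (tendsto_sum_nat_add fun k => |x a k|).eventually_lt_const (by positivity)
    obtain ⟨N, hN⟩ := eventually_atTop.1 (h1.and h2)
    obtain ⟨b, hb, hδb⟩ := hfreq (max N (a + 1))
    have hNb := hN b ((le_max_left _ _).trans hb)
    exact ⟨b, (le_max_right N (a + 1)).trans hb, hδb, hNb.1, hNb.2⟩
  choose next hlt hdiag hhead htail using hstep
  obtain ⟨r, hr⟩ : ∃ r : ℕ → ℕ, ∀ i, r (i + 1) = next (r i) :=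
    ⟨fun i => next^[i] 0, fun i => Function.iterate_succ_apply' next i 0⟩
  have hmono : StrictMono r := strictMono_nat_of_lt_succ fun i => by rw [hr]; exact hlt _
  let M : Set ℕ := Set.range r
  have hlarge : ∀ i, δ / 2 ≤ |∑' k, M.indicator (x (r (i + 1))) k| := by
    intro i
    obtain ⟨n, hn⟩ : ∃ n, n = r (i + 1) := ⟨_, rfl⟩
    obtain ⟨q, hq⟩ : ∃ q, q = r (i + 2) := ⟨_, rfl⟩
    have hnM : n ∈ M := ⟨i + 1, hn.symm⟩
    rw [← hn]
    let y : ℕ → ℝ := (M \ {n}).indicator (x n)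
    have hyle : ∀ k, |y k| ≤ |x n k| := fun k => by
      simpa only [Real.norm_eq_abs] using norm_indicator_le_norm_self (s := M \ {n}) (x n) k
    have hysum : Summable fun k => |y k| :=
      Summable.of_nonneg_of_le (fun _ => abs_nonneg _) hyle (hs n)
    have hsplit : ∑' k, M.indicator (x n) k = x n n + ∑' k, y k := by
      have hM : Summable (M.indicator (x n)) := (hs n).of_abs.indicator M
      rw [hM.tsum_eq_add_tsum_ite n]
      congr 1
      · exact Set.indicator_of_mem hnM (x n)
      · congr 1 with k
        by_cases hk : k = n
        · simp [hk, y]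
        · simp [hk, y, Set.indicator_apply]
    have hhead' : ∑ k ∈ Finset.range q, |y k| < δ / 4 := by
      have hsub : Finset.range (r i + 1) ⊆ Finset.range q :=
        Finset.range_subset_range.2 (hq ▸ hmono (by omega : i < i + 2))
      rw [← Finset.sum_subset hsub]
      · refine (Finset.sum_le_sum fun k _ => hyle k).trans_lt ?_
        rw [hn, hr]
        exact hhead (r i)
      · intro k hk hk'
        simp only [Finset.mem_range, hq] at hk hk'
        have : k ∉ M \ {n} := by
          rintro ⟨⟨j, rfl⟩, hj⟩
          have h1 : j < i + 2 := hmono.lt_iff_lt.1 hk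
          have h2 : i < j := hmono.lt_iff_lt.1 (by omega)
          exact hj (by rw [hn, show j = i + 1 by omega]; rfl)
        simp [y, this]
    have htail' : ∑' k, |y (k + q)| < δ / 4 := by
      refine lt_of_le_of_lt ?_ (htail n)
      rw [hn, ← hr (i + 1), ← hn, ← hq]
      exact ((summable_nat_add_iff q).2 hysum).tsum_le_tsum (fun k => hyle _)
        ((summable_nat_add_iff q).2 (hs n))
    have hyabs : |∑' k, y k| ≤ ∑' k, |y k| := by
      simpa only [Real.norm_eq_abs] using norm_tsum_le_tsum_norm (f := y) (by simpa using hysum)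
    rw [← hysum.sum_add_tsum_nat_add q] at hyabs
    have hd : δ ≤ |x n n| := by rw [hn, hr]; exact hdiag (r i)
    rw [hsplit]
    have := abs_sub_abs_le_abs_sub (x n n) (-∑' k, y k)
    rw [abs_neg, sub_neg_eq_add] at this
    linarith
  have hlim := ((h M).comp ((hmono.comp (strictMono_id.add_const 1)).tendsto_atTop)).abs
  have := ge_of_tendsto' hlim hlarge
  rw [abs_zero] at this
  linarith

section WeakConvergence

open StoneSpace BoundedCharge

variable {A : Type u} [BooleanAlgebra A]

theorem summable_abs_apply_ind (h : StrongDual ℝ C(StoneSpace A, ℝ)) {c : ℕ → A}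
    (hc : IsBooleanAntichain c) : Summable fun k => |h (ind (c k))| :=
  summable_of_sum_le (c := ‖h‖) (fun _ => abs_nonneg _) fun s =>
    sum_abs_apply_ind_le h s c fun i _ j _ hij => disjoint_iff.2 (hc i j hij)

/-- Along an antichain, summation over a set of indices is an element of the bidual. -/
theorem exists_bidual_tsum_indicator {c : ℕ → A} (hc : IsBooleanAntichain c) (M : Set ℕ) :
    ∃ φ : StrongDual ℝ (StrongDual ℝ C(StoneSpace A, ℝ)),
      ∀ h, φ h = ∑' k, M.indicator (fun k => h (ind (c k))) k := by
  have hs : ∀ h : StrongDual ℝ C(StoneSpace A, ℝ),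
      Summable (M.indicator fun k => h (ind (c k))) :=
    fun h => (summable_abs_apply_ind h hc).of_abs.indicator M
  let φ : StrongDual ℝ C(StoneSpace A, ℝ) →ₗ[ℝ] ℝ :=
    { toFun := fun h => ∑' k, M.indicator (fun k => h (ind (c k))) k
      map_add' := fun f g => by
        rw [← (hs f).tsum_add (hs g)]
        congr 1 with k
        by_cases hk : k ∈ M <;> simp [hk]
      map_smul' := fun r f => by
        rw [RingHom.id_apply, ← (hs f).tsum_const_smul r]
        congr 1 with k
        by_cases hk : k ∈ M <;> simp [hk] }
  refine ⟨⟨φ, AddMonoidHomClass.continuous_of_bound φ 1 fun h => ?_⟩, fun _ => rfl⟩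
  have habs := summable_abs_apply_ind h hc
  have hle : ∀ k, ‖M.indicator (fun k => h (ind (c k))) k‖ ≤ |h (ind (c k))| := fun k =>
    norm_indicator_le_norm_self _ k
  have hnorm : Summable fun k => ‖M.indicator (fun k => h (ind (c k))) k‖ :=
    Summable.of_nonneg_of_le (fun _ => norm_nonneg _) hle habs
  calc ‖φ h‖ ≤ ∑' k, ‖M.indicator (fun k => h (ind (c k))) k‖ := norm_tsum_le_tsum_norm hnorm
    _ ≤ ∑' k, |h (ind (c k))| := hnorm.tsum_le_tsum hle habs
    _ ≤ 1 * ‖h‖ := by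
        rw [one_mul]
        exact habs.tsum_le_of_sum_le fun s =>
          sum_abs_apply_ind_le h s c fun i _ j _ hij => disjoint_iff.2 (hc i j hij)

theorem tendsto_toWeakSpace_iff {X : Type*} [NormedAddCommGroup X] [NormedSpace ℝ X]
    {f : ℕ → X} {g : X} :
    Tendsto (fun n => toWeakSpace ℝ X (f n)) atTop (𝓝 (toWeakSpace ℝ X g)) ↔
      ∀ φ : StrongDual ℝ X, Tendsto (fun n => φ (f n)) atTop (𝓝 (φ g)) := by
  refine WeakBilin.tendsto_iff_forall_eval_tendsto _ fun x y hxy => ?_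
  exact (SeparatingDual.eq_iff_forall_dual_eq (R := ℝ)).2 fun φ => LinearMap.congr_fun hxy φ

theorem tendsto_toWeakDual_iff {X : Type*} [NormedAddCommGroup X] [NormedSpace ℝ X]
    {f : ℕ → StrongDual ℝ X} {g : StrongDual ℝ X} :
    Tendsto (fun n => StrongDual.toWeakDual (f n)) atTop (𝓝 (StrongDual.toWeakDual g)) ↔
      ∀ x, Tendsto (fun n => f n x) atTop (𝓝 (g x)) :=
  tendsto_iff_forall_eval_tendsto_topDualPairing

/-- In the dual of a Grothendieck space of the form `C(St(A))`, a bounded sequence of charges that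
converges pointwise on `A` cannot keep a fixed amount of variation on the terms of an antichain. -/
theorem HasGrothendieckProperty.exists_not_tendsto (hA : HasGrothendieckProperty A)
    {ν : ℕ → BoundedCharge A} {C : ℝ} (hC : ∀ n, ‖ν n‖ ≤ C) {H : ℕ → A}
    (hH : IsBooleanAntichain H) {δ : ℝ} (hδ : 0 < δ) (hν : ∀ n, δ ≤ (ν n).variation (H n)) :
    ∃ B : A, ¬ ∃ L : ℝ, Tendsto (fun n => ν n B) atTop (𝓝 L) := by
  by_contra! hconv
  choose f hf hfn _ using fun n => (ν n).exists_dual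
  obtain ⟨g, hg⟩ := exists_dual_tendsto (fun n => (hfn n).trans (hC n)) fun a => by
    simpa only [hf] using hconv a
  obtain ⟨g', hg'⟩ := hA f ⟨StrongDual.toWeakDual g, tendsto_toWeakDual_iff.2 hg⟩
  obtain ⟨k, rfl⟩ := (toWeakSpace ℝ (StrongDual ℝ C(StoneSpace A, ℝ))).surjective g'
  rw [tendsto_toWeakSpace_iff] at hg'
  choose c hcH hcν using fun n => (ν n).exists_variation_le_mul_abs (H n)
  have hc : IsBooleanAntichain c := fun i j hij =>
    ((disjoint_iff.2 (hH i j hij)).mono (hcH i) (hcH j)).eq_bot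
  have hdiag := tendsto_diag_of_tendsto_tsum_indicator (x := fun n j => (f n - k) (ind (c j)))
    (fun n => summable_abs_apply_ind (f n - k) hc) fun M => by
      obtain ⟨φ, hφ⟩ := exists_bidual_tsum_indicator hc M
      simp only [← hφ, map_sub]
      simpa only [sub_self] using (hg' φ).sub_const (φ k)
  have hk : Tendsto (fun n => k (ind (c n))) atTop (𝓝 0) :=
    (summable_abs_apply_ind k hc).of_abs.tendsto_atTop_zero
  have h0 := (hdiag.add hk).abs
  simp only [sub_apply, sub_add_cancel, hf, add_zero, abs_zero] at h0
  have : δ / 4 ≤ 0 := ge_of_tendsto' h0 fun n => by linarith [hν n, hcν n]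
  linarith

end WeakConvergence

/-! ### Sequences of functionals that are weak* null but not weakly null -/

section WeakStarNull

open StoneSpace BoundedCharge

/-- Goldstine's theorem in terms of finitely many functionals: a bidual element is approximated on
them by a vector of at most the same norm. -/
theorem exists_norm_le_abs_apply_sub_lt {X : Type*} [NormedAddCommGroup X] [NormedSpace ℝ X]
    (φ : StrongDual ℝ (StrongDual ℝ X)) {ι : Type*} [Fintype ι] (h : ι → StrongDual ℝ X) {ε : ℝ}
    (hε : 0 < ε) : ∃ f : X, ‖f‖ ≤ ‖φ‖ ∧ ∀ i, |h i f - φ (h i)| < ε := by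
  classical
  let T : X →L[ℝ] (ι → ℝ) := ContinuousLinearMap.pi h
  let S : Set (ι → ℝ) := T '' Metric.closedBall 0 ‖φ‖
  have hS : Convex ℝ S := (convex_closedBall 0 ‖φ‖).is_linear_image T.toLinearMap.isLinear
  have hmem : (fun i => φ (h i)) ∈ closure S := by
    by_contra hn
    obtain ⟨l, w, hl, hlw⟩ := geometric_hahn_banach_closed_point hS.closure isClosed_closure hn
    let H : StrongDual ℝ X := ∑ i, l (Pi.single i 1) • h i
    have hlsum : ∀ y : ι → ℝ, l y = ∑ i, l (Pi.single i 1) * y i := by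
      intro y
      have := LinearMap.pi_apply_eq_sum_univ l.toLinearMap y
      simp only [ContinuousLinearMap.coe_coe, smul_eq_mul] at this
      rw [this]
      refine Finset.sum_congr rfl fun i _ => ?_
      rw [mul_comm]
      congr 2
      ext j
      simp [Pi.single_apply, eq_comm]
    have hHT : ∀ f, H f = l (T f) := fun f => by
      rw [hlsum]
      simp [H, T]
    have hφH : φ H = l fun i => φ (h i) := by
      rw [hlsum]
      simp [H]
    have hball : ∀ f : X, ‖f‖ ≤ ‖φ‖ → H f < w := fun f hf => by
      rw [hHT]
      exact hl _ (subset_closure ⟨f, by simpa using hf, rfl⟩)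
    have hw : 0 < w := by simpa using hball 0 (by rw [norm_zero]; exact norm_nonneg φ)
    have hle : ‖φ‖ * ‖H‖ ≤ w := by
      rcases (norm_nonneg φ).eq_or_lt with h0 | h0
      · rw [← h0, zero_mul]; exact hw.le
      rw [mul_comm, ← le_div_iff₀ h0]
      refine ContinuousLinearMap.opNorm_le_of_unit_norm (by positivity) fun z hz => ?_
      rw [le_div_iff₀ h0, Real.norm_eq_abs, ← abs_of_pos h0, ← abs_mul, abs_le]
      have h1 := hball (‖φ‖ • z) (by rw [norm_smul, Real.norm_of_nonneg h0.le, hz, mul_one])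
      have h2 := hball (-(‖φ‖ • z)) (by
        rw [norm_neg, norm_smul, Real.norm_of_nonneg h0.le, hz, mul_one])
      rw [map_neg] at h2
      rw [map_smul, smul_eq_mul] at h1 h2
      constructor <;> linarith
    rw [← hφH] at hlw
    exact absurd (((le_abs_self _).trans (φ.le_opNorm H)).trans hle) (not_le.2 hlw)
  obtain ⟨_, ⟨f, hf, rfl⟩, hd⟩ := Metric.mem_closure_iff.1 hmem ε hε
  refine ⟨f, by simpa using hf, fun i => ?_⟩
  have := (dist_pi_lt_iff hε).1 hd i
  rwa [Real.dist_eq, abs_sub_comm] at this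

/-- If an element of the bidual is at least `η` on a sequence of functionals, then the functionals
with index `< n` are simultaneously at least `η / 2` at some vector, whose norm is bounded
independently of `n`. -/
theorem exists_norm_bound_of_le_bidual {X : Type*} [NormedAddCommGroup X] [NormedSpace ℝ X]
    (h : ℕ → StrongDual ℝ X) (φ : StrongDual ℝ (StrongDual ℝ X)) {η : ℝ} (hη : 0 < η)
    (hφ : ∀ n, η ≤ φ (h n)) :
    ∃ R : ℝ, 0 ≤ R ∧ ∀ n, ∃ f : X, ‖f‖ ≤ R ∧ ∀ i < n, η / 2 ≤ h i f := by
  refine ⟨‖φ‖, norm_nonneg φ, fun n => ?_⟩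
  obtain ⟨f, hf, hi⟩ := exists_norm_le_abs_apply_sub_lt φ (fun i : Fin n => h i)
    (show 0 < η / 2 by positivity)
  refine ⟨f, hf, fun i hin => ?_⟩
  have := (abs_lt.1 (hi ⟨i, hin⟩)).1
  simp only at this
  linarith [hφ i]

/-- Let `hₙ` be a weak* null sequence such that any finitely many of the `hᵢ` are simultaneously
large at some function from a fixed ball. Then there are bounded functions, as small as desired for
a given Hilbertian seminorm `f ↦ √Λ(f²)`, at which some `hᵢ` is large. They arise as differences of
nearly minimal elements of the decreasing convex sets `{f | η / 2 ≤ hᵢ(f) for all i < n}`. -/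
theorem exists_apply_sq_le {K : Type*} [TopologicalSpace K] [CompactSpace K]
    {h : ℕ → StrongDual ℝ C(K, ℝ)} (hnull : ∀ f, Tendsto (fun n => h n f) atTop (𝓝 0))
    {R η : ℝ} (hη : 0 < η) (hR : ∀ n, ∃ f : C(K, ℝ), ‖f‖ ≤ R ∧ ∀ i < n, η / 2 ≤ h i f)
    (Λ : StrongDual ℝ C(K, ℝ)) (hΛ : ∀ f, 0 ≤ Λ (f * f)) {κ : ℝ} (hκ : 0 < κ) :
    ∃ (f : C(K, ℝ)) (i : ℕ), ‖f‖ ≤ 2 * R ∧ η / 4 ≤ h i f ∧ Λ (f * f) ≤ κ := by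
  let D : ℕ → Set C(K, ℝ) := fun n => {f | ‖f‖ ≤ R ∧ ∀ i < n, η / 2 ≤ h i f}
  have hDne : ∀ n, (D n).Nonempty := hR
  have hDanti : ∀ {m n}, m ≤ n → D n ⊆ D m := fun hmn f hf =>
    ⟨hf.1, fun i hi => hf.2 i (hi.trans_le hmn)⟩
  let q : C(K, ℝ) → ℝ := fun f => Λ (f * f)
  let d : ℕ → ℝ := fun n => sInf (q '' D n)
  have hbelow : ∀ n, BddBelow (q '' D n) := fun n => ⟨0, by rintro _ ⟨f, -, rfl⟩; exact hΛ f⟩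
  have hdle : ∀ {n f}, f ∈ D n → d n ≤ q f := fun hf => csInf_le (hbelow _) ⟨_, hf, rfl⟩
  have hdmono : Monotone d := fun m n hmn =>
    csInf_le_csInf (hbelow m) ((hDne n).image q) (Set.image_mono (hDanti hmn))
  have hdbdd : BddAbove (Set.range d) := by
    refine ⟨‖Λ‖ * (R * R), ?_⟩
    rintro _ ⟨n, rfl⟩
    obtain ⟨f, hf⟩ := hDne n
    calc d n ≤ q f := hdle hf
      _ ≤ ‖Λ‖ * ‖f * f‖ := (le_abs_self _).trans (Λ.le_opNorm _)
      _ ≤ ‖Λ‖ * (R * R) := by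
          refine mul_le_mul_of_nonneg_left ((norm_mul_le f f).trans ?_) (norm_nonneg Λ)
          exact mul_le_mul hf.1 hf.1 (norm_nonneg _) ((norm_nonneg f).trans hf.1)
  have hnear : ∀ n, ∃ f ∈ D n, q f < d n + κ / 6 := by
    intro n
    obtain ⟨_, ⟨f, hf, rfl⟩, hlt⟩ :=
      exists_lt_of_csInf_lt ((hDne n).image q) (show sInf (q '' D n) < d n + κ / 6 by
        simp only [d]; linarith)
    exact ⟨f, hf, hlt⟩
  obtain ⟨n, hn⟩ := exists_lt_of_lt_ciSup (show (⨆ n, d n) - κ / 6 < ⨆ n, d n by linarith)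
  obtain ⟨g, hg, hgq⟩ := hnear n
  obtain ⟨i, hi, hni⟩ := (((hnull g).eventually_lt_const (show 0 < η / 4 by positivity)).and
    (eventually_ge_atTop n)).exists
  obtain ⟨g', hg', hgq'⟩ := hnear (i + 1)
  refine ⟨g' - g, i, ?_, ?_, ?_⟩
  · linarith [norm_sub_le g' g, hg.1, hg'.1]
  · rw [map_sub]
    linarith [hg'.2 i (Nat.lt_succ_self i)]
  · have hmid : (1 / 2 : ℝ) • (g + g') ∈ D n := by
      have hg'n := hDanti (hni.trans (Nat.le_succ i)) hg'
      refine ⟨?_, fun j hj => ?_⟩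
      · rw [norm_smul, Real.norm_of_nonneg (by norm_num)]
        linarith [norm_add_le g g', hg.1, hg'.1]
      · rw [map_smul, map_add, smul_eq_mul]
        linarith [hg.2 j hj, hg'n.2 j hj]
    have h1 := hdle hmid
    have h2 : d (i + 1) ≤ ⨆ n, d n := le_ciSup hdbdd _
    -- the parallelogram identity for `f ↦ Λ(f²)`
    have h3 : q ((1 / 2 : ℝ) • (g + g')) * 4 + Λ ((g' - g) * (g' - g)) = 2 * q g + 2 * q g' := by
      simp only [q, add_mul, mul_add, sub_mul, mul_sub, smul_mul_assoc, mul_smul_comm, map_smul,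
        map_add, map_sub, smul_eq_mul]
      ring
    linarith

variable {A : Type u} [BooleanAlgebra A]

/-- If any finitely many terms of a bounded weak* null sequence are simultaneously large at some
function from a fixed ball, then the charges of the sequence are not uniformly exhaustive. -/
theorem exists_antichain_of_forall_exists {h : ℕ → StrongDual ℝ C(StoneSpace A, ℝ)} {C : ℝ}
    (hC : ∀ n, ‖h n‖ ≤ C) (hnull : ∀ f, Tendsto (fun n => h n f) atTop (𝓝 0))
    {R η : ℝ} (hR0 : 0 ≤ R) (hη : 0 < η)
    (hR : ∀ n, ∃ f : C(StoneSpace A, ℝ), ‖f‖ ≤ R ∧ ∀ i < n, η / 2 ≤ h i f) :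
    ∃ c : ℕ → A, IsBooleanAntichain c ∧ ∃ δ > 0, ∃ n : ℕ → ℕ,
      ∀ k, δ ≤ (ofDual (h (n k))).variation (c k) := by
  have hC0 : 0 ≤ C := (norm_nonneg (h 0)).trans (hC 0)
  have hν : ∀ n, ‖ofDual (h n)‖ ≤ C := fun n => (norm_ofDual_le _).trans (hC n)
  obtain ⟨Λ, hΛ, -, hpos⟩ := (control (fun n => ofDual (h n)) C hν).exists_dual
  have hpos := hpos (control_nonneg _ C hν)
  refine exists_antichain_of_control (fun n => ofDual (h n)) hν
    (δ := η / (16 * (R + 1))) (by positivity) fun κ hκ => ?_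
  -- chosen so that the error `3 * τ * ‖h i‖` is at most half of the lower bound `η / 4`
  set τ : ℝ := η / (24 * (C + 1)) with hτdef
  have hτ : 0 < τ := by positivity
  obtain ⟨f, i, hf, hfi, hΛf⟩ := exists_apply_sq_le hnull hη hR Λ
    (fun f => hpos (f * f) fun x => mul_self_nonneg _) (show 0 < τ ^ 2 * (κ / 2) by positivity)
  obtain ⟨e, hef, he⟩ := exists_abs_apply_le (h i) f hτ
  refine ⟨e, i, ?_, ?_⟩
  · -- Chebyshev's inequality for the positive functional `Λ`
    have h1 := hpos (f * f - τ ^ 2 • ind e) fun x => by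
      rw [ContinuousMap.sub_apply, ContinuousMap.mul_apply, ContinuousMap.smul_apply, smul_eq_mul,
        sub_nonneg]
      by_cases hx : e ∈ x.carrier
      · rw [ind_of_mem hx, mul_one, ← abs_mul_abs_self (f x), sq]
        exact mul_self_le_mul_self hτ.le (hef x hx)
      · rw [ind_of_notMem hx, mul_zero]
        exact mul_self_nonneg _
    rw [map_sub, map_smul, smul_eq_mul, hΛ] at h1
    have h2 : τ ^ 2 * control (fun n => ofDual (h n)) C hν e ≤ τ ^ 2 * (κ / 2) := by linarith
    have h3 := le_of_mul_le_mul_left h2 (by positivity)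
    linarith
  · have h1 : 3 * τ * ‖h i‖ ≤ η / 8 := by
      calc 3 * τ * ‖h i‖ ≤ 3 * τ * (C + 1) :=
            mul_le_mul_of_nonneg_left ((hC i).trans (by linarith)) (by positivity)
        _ = η / 8 := by rw [hτdef]; field_simp; norm_num
    have h2 : ‖f‖ * (ofDual (h i)).variation e ≤
        2 * (R + 1) * (ofDual (h i)).variation e :=
      mul_le_mul_of_nonneg_right (by linarith) (variation_nonneg _ _)
    have h3 : η / 8 ≤ 2 * (R + 1) * (ofDual (h i)).variation e := by
      linarith [le_abs_self (h i f)]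
    rw [div_le_iff₀ (by positivity)]
    linarith

/-- Normalizing the charges obtained from `exists_antichain_of_forall_exists`. Only some `ε < 1`,
depending on the sequence, is reached. -/
theorem exists_normalized_antichain {h : ℕ → StrongDual ℝ C(StoneSpace A, ℝ)} {C : ℝ}
    (hC : ∀ n, ‖h n‖ ≤ C) (hnull : ∀ f, Tendsto (fun n => h n f) atTop (𝓝 0))
    {R η : ℝ} (hR0 : 0 ≤ R) (hη : 0 < η)
    (hR : ∀ n, ∃ f : C(StoneSpace A, ℝ), ‖f‖ ≤ R ∧ ∀ i < n, η / 2 ≤ h i f) :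
    ∃ ε : ℝ, 0 < ε ∧ ε < 1 ∧ ∃ μ : ℕ → BoundedCharge A, (∀ n, ‖μ n‖ = 1) ∧
      (∃ H : ℕ → A, IsBooleanAntichain H ∧ ∀ n, 1 - ε ≤ (μ n).variation (H n)) ∧
      ∀ B, Tendsto (fun n => μ n B) atTop (𝓝 0) := by
  obtain ⟨c, hc, δ, hδ, n, hn⟩ := exists_antichain_of_forall_exists hC hnull hR0 hη hR
  have htop := tendsto_atTop_of_le_variation (fun n => ofDual (h n)) hc hδ hn
  have hlow : ∀ k, δ ≤ ‖ofDual (h (n k))‖ := fun k => (hn k).trans (variation_mono _ le_top)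
  have hup : ∀ k, ‖ofDual (h (n k))‖ ≤ C := fun k => (norm_ofDual_le _).trans (hC _)
  have hpos : ∀ k, 0 < ‖ofDual (h (n k))‖ := fun k => hδ.trans_le (hlow k)
  have hC0 : 0 < C := (hpos 0).trans_le (hup 0)
  refine ⟨1 - δ / (C + 1), ?_, ?_, fun k => smul ‖ofDual (h (n k))‖⁻¹ (ofDual (h (n k))), ?_,
    ⟨c, hc, ?_⟩, ?_⟩
  · rw [sub_pos, div_lt_one (by positivity)]
    linarith [hlow 0, hup 0]
  · have : 0 < δ / (C + 1) := by positivity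
    linarith
  · intro k
    rw [norm_def, variation_smul, abs_of_pos (inv_pos.2 (hpos k)), ← norm_def,
      inv_mul_cancel₀ (hpos k).ne']
  · intro k
    rw [variation_smul, abs_of_pos (inv_pos.2 (hpos k)), sub_sub_cancel, div_eq_inv_mul]
    refine mul_le_mul (inv_anti₀ (hpos k) ?_) (hn k) hδ.le (inv_pos.2 (hpos k)).le
    linarith [hup k]
  · intro B
    have h1 : Tendsto (fun k => δ⁻¹ * |h (n k) (ind B)|) atTop (𝓝 (δ⁻¹ * |0|)) :=
      (((hnull (ind B)).comp htop).abs).const_mul _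
    rw [abs_zero, mul_zero] at h1
    refine squeeze_zero_norm (fun k => ?_) h1
    change |‖ofDual (h (n k))‖⁻¹ * h (n k) (ind B)| ≤ _
    rw [abs_mul, abs_of_pos (inv_pos.2 (hpos k))]
    exact mul_le_mul_of_nonneg_right (inv_anti₀ hδ (hlow k)) (abs_nonneg _)

end WeakStarNull

/-! ### The characterization -/

theorem lemma2p9 (A : Type u) [BooleanAlgebra A] :
    HasGrothendieckProperty A ↔
      ∀ ε : ℝ, 0 < ε → ε < 1 → ∀ ν : ℕ → BoundedCharge A, (∀ n, ‖ν n‖ = 1) →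
        (∃ H : ℕ → A, IsBooleanAntichain H ∧ ∀ n, 1 - ε ≤ (ν n).variation (H n)) →
        ∃ B : A, ¬ ∃ L : ℝ, Tendsto (fun n => ν n B) atTop (𝓝 L) := by
  constructor
  · rintro hA ε - hε1 ν hν ⟨H, hH, hνH⟩
    exact hA.exists_not_tendsto (fun n => (hν n).le) hH (sub_pos.2 hε1) hνH
  · rintro hA f ⟨g, hg⟩
    obtain ⟨g, rfl⟩ := (StrongDual.toWeakDual (𝕜 := ℝ) (E := C(StoneSpace A, ℝ))).surjective g
    rw [tendsto_toWeakDual_iff] at hg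
    refine ⟨toWeakSpace ℝ _ g, tendsto_toWeakSpace_iff.2 fun φ => ?_⟩
    have hnull : ∀ x, Tendsto (fun n => (f n - g) x) atTop (𝓝 0) := fun x => by
      simpa using (hg x).sub_const (g x)
    obtain ⟨C, hC⟩ := banach_steinhaus (g := fun n => f n - g) fun x => by
      obtain ⟨C, hC⟩ := (hnull x).norm.bddAbove_range
      exact ⟨C, fun n => hC ⟨n, rfl⟩⟩
    by_contra hcon
    rw [Metric.tendsto_atTop] at hcon
    push Not at hcon
    obtain ⟨η, hη, hfreq⟩ := hcon
    have hfreq' : ∃ᶠ n in atTop, η ≤ φ (f n - g) ∨ η ≤ (-φ) (f n - g) :=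
      frequently_atTop.2 fun N => by
        obtain ⟨n, hn, h⟩ := hfreq N
        rw [Real.dist_eq, ← map_sub] at h
        exact ⟨n, hn, le_abs.1 h⟩
    have key : ∀ ψ : StrongDual ℝ (StrongDual ℝ C(StoneSpace A, ℝ)),
        ¬ ∃ᶠ n in atTop, η ≤ ψ (f n - g) := by
      intro ψ hψ
      obtain ⟨r, hr, hrψ⟩ := extraction_of_frequently_atTop hψ
      obtain ⟨R, hR0, hR⟩ := exists_norm_bound_of_le_bidual (fun n => f (r n) - g) ψ hη hrψ
      obtain ⟨ε, hε, hε1, μ, hμ, hH, hlim⟩ := exists_normalized_antichain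
        (fun n => hC (r n)) (fun x => (hnull x).comp hr.tendsto_atTop) hR0 hη hR
      obtain ⟨B, hB⟩ := hA ε hε hε1 μ hμ hH
      exact hB ⟨0, hlim B⟩
    rcases frequently_or_distrib.1 hfreq' with h | h
    · exact key φ h
    · exact key (-φ) h
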